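/- Let $\Gamma$ be an arbitrary group with identity $\varepsilon$. Rings are unital, and a $\Gamma$-graded ring is a ring $R=\bigoplus_{\gamma\in\Gamma}R_\gamma$, with additive subgroups $R_\gamma$ such that $R_\gamma R_\delta\subseteq R_{\gamma\delta}$. Let $\mathrm{Gr}\text{-}R$ be the category of $\Gamma$-graded right $R$-modules $M=\bigoplus_\gamma M_\gamma$ ($M_\gamma R_\delta\subseteq M_{\gamma\delta}$), with the $R$-linear maps $f$ such that $f(M_\gamma)\subseteq N_\gamma$ for all $\gamma$ as morphisms. For $\gamma\in\Gamma$ the shift $(\gamma)M$ is the module $M$ graded by $(\gamma)M_\delta=M_{\gamma\delta}$. Two $\Gamma$-graded rings $A$ and $B$ are graded Morita equivalent if there is an equivalence of categories $\mathrm{Gr}\text{-}A\to\mathrm{Gr}\text{-}B$ that commutes with all shifts (up to natural isomorphisms compatible with the composition of shifts). For a $\Gamma$-graded right $R$-module $M$ let $$\operatorname{END}_R(M)_\gamma=\{f\in\operatorname{End}_R(M)\mid f(M_\delta)\subseteq M_{\gamma\delta}\text{ for all }\delta\in\Gamma\},\qquad \operatorname{END}_R(M)=\bigoplus_{\gamma\in\Gamma}\operatorname{END}_R(M)_\gamma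 .$$ A unital ring $S$ is an exchange ring if for every $x\in S$ there is an idempotent $e\in xS$ with $1-e\in(1-x)S$. A $\Gamma$-graded unital ring $R$ satisfies $\mathrm{Exch}_\varepsilon$ if the ring $\operatorname{END}_R(R_R)_\varepsilon$ is an exchange ring. **Proposition.** The condition $\mathrm{Exch}_\varepsilon$ is graded Morita invariant for graded unital rings: if $A$ and $B$ are graded Morita equivalent $\Gamma$-graded unital rings, then $A$ satisfies $\mathrm{Exch}_\varepsilon$ if and only if $B$ satisfies $\mathrm{Exch}_\varepsilon$. -/

import Mathlib

open CategoryTheory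

universe w u v

/-! Throughout, `Γ` is an arbitrary group, not assumed commutative.  It is written additively because
this is the convention of Mathlib's `GradedRing`: the group operation is `+` and the identity
element `ε` is `0`.  A right `A`-module is a module over `Aᵐᵒᵖ`. -/

/-- A unital ring `R` is an exchange ring if for every `x` there is an idempotent `e ∈ xR` such that
`1 - e ∈ (1 - x)R`. -/
def IsExchangeRing (R : Type*) [Ring R] : Prop :=
  ∀ x : R, ∃ e : R, IsIdempotentElem e ∧ (∃ r : R, e = x * r) ∧ ∃ s : R, 1 - e = (1 - x) * s

section GradedHom

variable {Γ : Type*} [AddGroup Γ] {A : Type*} [Ring A]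
  {M : Type*} [AddCommGroup M] [Module Aᵐᵒᵖ M] {N : Type*} [AddCommGroup N] [Module Aᵐᵒᵖ N]

/-- `Hom_A(M, N)_γ`: the homomorphisms `f : M → N` of right `A`-modules such that
`f (M_δ) ⊆ N_{γδ}` for all `δ`. -/
def homOfDegree (ℳ : Γ → AddSubgroup M) (𝒩 : Γ → AddSubgroup N) (γ : Γ) :
    AddSubgroup (M →ₗ[Aᵐᵒᵖ] N) where
  carrier := {f | ∀ δ : Γ, ∀ m ∈ ℳ δ, f m ∈ 𝒩 (γ + δ)}
  zero_mem' := fun _ _ _ => zero_mem _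
  add_mem' := fun hf hg δ m hm => add_mem (hf δ m hm) (hg δ m hm)
  neg_mem' := fun hf δ m hm => neg_mem (hf δ m hm)

theorem one_mem_homOfDegree (ℳ : Γ → AddSubgroup M) :
    (1 : Module.End Aᵐᵒᵖ M) ∈ homOfDegree (A := A) ℳ ℳ 0 := fun δ m hm => by
  simpa using hm

theorem mul_mem_homOfDegree {ℳ : Γ → AddSubgroup M} {γ δ : Γ} {f g : Module.End Aᵐᵒᵖ M}
    (hf : f ∈ homOfDegree (A := A) ℳ ℳ γ) (hg : g ∈ homOfDegree (A := A) ℳ ℳ δ) :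
    f * g ∈ homOfDegree (A := A) ℳ ℳ (γ + δ) := fun l m hm => by
  rw [add_assoc]
  exact hf _ _ (hg _ _ hm)

variable (A) in
/-- `END_A(M)`: the ring of all sums of homogeneous endomorphisms of the right `A`-module `M`. -/
def gradedEnd (ℳ : Γ → AddSubgroup M) : Subring (Module.End Aᵐᵒᵖ M) where
  __ := (⨆ γ : Γ, homOfDegree (A := A) ℳ ℳ γ : AddSubgroup (Module.End Aᵐᵒᵖ M))
  one_mem' := AddSubgroup.mem_iSup_of_mem 0 (one_mem_homOfDegree ℳ)
  mul_mem' := by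
    intro f g hf hg
    change f ∈ ⨆ γ : Γ, homOfDegree (A := A) ℳ ℳ γ at hf
    change g ∈ ⨆ γ : Γ, homOfDegree (A := A) ℳ ℳ γ at hg
    change f * g ∈ ⨆ γ : Γ, homOfDegree (A := A) ℳ ℳ γ
    induction hf using AddSubgroup.iSup_induction' with
    | h1 => rw [zero_mul]; exact zero_mem _
    | hadd a b _ _ ha hb => rw [add_mul]; exact add_mem ha hb
    | hp γ f hf =>
      induction hg using AddSubgroup.iSup_induction' with
      | h1 => rw [mul_zero]; exact zero_mem _
      | hadd a b _ _ ha hb => rw [mul_add]; exact add_mem ha hb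
      | hp δ g hg => exact AddSubgroup.mem_iSup_of_mem (γ + δ) (mul_mem_homOfDegree hf hg)

variable (A) in
/-- `END_A(M)_ε`: the identity component of the graded ring `END_A(M)`, a unital subring. -/
def gradedEndZero (ℳ : Γ → AddSubgroup M) : Subring (gradedEnd A ℳ) where
  carrier := {f | (f : Module.End Aᵐᵒᵖ M) ∈ homOfDegree (A := A) ℳ ℳ 0}
  zero_mem' := zero_mem (homOfDegree (A := A) ℳ ℳ 0)
  one_mem' := one_mem_homOfDegree ℳ
  add_mem' := fun {f g} hf hg => (homOfDegree (A := A) ℳ ℳ 0).add_mem (x := f) (y := g) hf hg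
  neg_mem' := fun {f} hf => (homOfDegree (A := A) ℳ ℳ 0).neg_mem (x := f) hf
  mul_mem' := fun {f g} hf hg => by
    have h := mul_mem_homOfDegree (A := A) (ℳ := ℳ) hf hg
    rw [add_zero] at h
    exact h

/-- The condition `Exch_ε` on a graded unital ring `A`: the ring `END_A(A_A)_ε` is exchange. -/
def EpsilonExchange (𝒜 : Γ → AddSubgroup A) : Prop :=
  IsExchangeRing (gradedEndZero A 𝒜)

end GradedHom

section GrMod

variable {Γ : Type*} [AddGroup Γ] [DecidableEq Γ] {A : Type*} [Ring A]

/-- The objects of the category `Gr-A`: right `A`-modules `M` with an internal direct sum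
decomposition `M = ⨁ M_γ` into additive subgroups such that `M_γ A_δ ⊆ M_{γδ}`. -/
structure GrMod (𝒜 : Γ → AddSubgroup A) [GradedRing 𝒜] where
  carrier : Type w
  [addCommGroup : AddCommGroup carrier]
  [module : Module Aᵐᵒᵖ carrier]
  component : Γ → AddSubgroup carrier
  isInternal : DirectSum.IsInternal component
  smul_mem : ∀ (γ δ : Γ) (m : carrier) (a : A), m ∈ component γ → a ∈ 𝒜 δ →
    MulOpposite.op a • m ∈ component (γ + δ)

namespace GrMod

attribute [instance] GrMod.addCommGroup GrMod.module

variable {𝒜 : Γ → AddSubgroup A} [GradedRing 𝒜]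

/-- The morphisms of `Gr-A`: homomorphisms of right `A`-modules with `f (M_γ) ⊆ N_γ`. -/
@[ext]
structure Hom (M N : GrMod.{w} 𝒜) where
  toLinearMap : M.carrier →ₗ[Aᵐᵒᵖ] N.carrier
  map_mem : ∀ (γ : Γ), ∀ m ∈ M.component γ, toLinearMap m ∈ N.component γ

instance : Category (GrMod.{w} 𝒜) where
  Hom M N := Hom M N
  id _ := ⟨LinearMap.id, fun _ _ h => h⟩
  comp f g := ⟨g.toLinearMap.comp f.toLinearMap, fun γ m h => g.map_mem γ _ (f.map_mem γ m h)⟩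

@[ext]
theorem hom_ext {M N : GrMod.{w} 𝒜} {f g : M ⟶ N} (h : f.toLinearMap = g.toLinearMap) : f = g :=
  Hom.ext h

@[simp]
theorem id_toLinearMap (M : GrMod.{w} 𝒜) : Hom.toLinearMap (𝟙 M) = LinearMap.id := rfl

@[simp]
theorem comp_toLinearMap {M N P : GrMod.{w} 𝒜} (f : M ⟶ N) (g : N ⟶ P) :
    Hom.toLinearMap (f ≫ g) = g.toLinearMap.comp f.toLinearMap := rfl

theorem isInternal_shift {M : Type*} [AddCommGroup M] {ℳ : Γ → AddSubgroup M}
    (h : DirectSum.IsInternal ℳ) (γ : Γ) : DirectSum.IsInternal fun δ => ℳ (γ + δ) := by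
  let e : DirectSum Γ (fun i => ℳ i) ≃+ DirectSum Γ (fun δ => ℳ (γ + δ)) :=
    DirectSum.equivCongrLeft (β := fun i => ℳ i) (Equiv.addLeft γ).symm
  have key : ∀ x, DirectSum.coeAddMonoidHom (fun δ => ℳ (γ + δ)) (e x) =
      DirectSum.coeAddMonoidHom ℳ x := by
    intro x
    induction x using DirectSum.induction_on with
    | zero => simp
    | add x y hx hy => rw [map_add, map_add, map_add, hx, hy]
    | of i x =>
      obtain ⟨k, rfl⟩ := (Equiv.addLeft γ).surjective i
      have h1 : e (DirectSum.of (fun i => ℳ i) (Equiv.addLeft γ k) x) =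
          DirectSum.of (fun δ => ℳ (γ + δ)) k x :=
        DirectSum.equivCongrLeft_of (β := fun i => ℳ i) (Equiv.addLeft γ).symm k x
      refine (congrArg (DirectSum.coeAddMonoidHom fun δ => ℳ (γ + δ)) h1).trans ?_
      exact (DirectSum.coeAddMonoidHom_of (fun δ => ℳ (γ + δ)) k x).trans
        (DirectSum.coeAddMonoidHom_of ℳ (γ + k) x).symm
  have h2 : Function.Bijective (DirectSum.coeAddMonoidHom (fun δ => ℳ (γ + δ)) ∘ e) := by
    rw [show DirectSum.coeAddMonoidHom (fun δ => ℳ (γ + δ)) ∘ e = DirectSum.coeAddMonoidHom ℳ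
      from funext key]
    exact h
  exact (Function.Bijective.of_comp_iff _ e.bijective).1 h2

/-- The shifted module `(γ)M`: the module `M` with the grading `(γ)M_δ = M_{γδ}`. -/
def shiftObj (γ : Γ) (M : GrMod.{w} 𝒜) : GrMod.{w} 𝒜 where
  carrier := M.carrier
  component δ := M.component (γ + δ)
  isInternal := isInternal_shift M.isInternal γ
  smul_mem i j m a hm ha := by
    rw [← add_assoc]
    exact M.smul_mem _ _ m a hm ha

/-- The shift functor `M ↦ (γ)M`, the identity on underlying homomorphisms. -/
def shift (γ : Γ) : GrMod.{w} 𝒜 ⥤ GrMod.{w} 𝒜 where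
  obj := shiftObj γ
  map {M N} f := (⟨f.toLinearMap, fun δ m h => f.map_mem (γ + δ) m h⟩ :
    Hom (shiftObj γ M) (shiftObj γ N))

theorem mem_congr (M : GrMod.{w} 𝒜) {γ δ : Γ} (h : γ = δ) {m : M.carrier}
    (hm : m ∈ M.component γ) : m ∈ M.component δ := h ▸ hm

/-- The identity map, as an isomorphism between two objects with the same underlying module and the
same grading. -/
def shiftZeroIso (M : GrMod.{w} 𝒜) : shiftObj 0 M ≅ M where
  hom := (⟨LinearMap.id, fun δ _ h => M.mem_congr (zero_add δ) h⟩ : Hom (shiftObj 0 M) M)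
  inv := (⟨LinearMap.id, fun δ _ h => M.mem_congr (zero_add δ).symm h⟩ : Hom M (shiftObj 0 M))

/-- The identity map, as an isomorphism from `(γδ)M` to `(δ)((γ)M)`. -/
def shiftAddIso (γ δ : Γ) (M : GrMod.{w} 𝒜) :
    shiftObj (γ + δ) M ≅ shiftObj δ (shiftObj γ M) where
  hom := (⟨LinearMap.id, fun l _ h => M.mem_congr (add_assoc γ δ l) h⟩ :
    Hom (shiftObj (γ + δ) M) (shiftObj δ (shiftObj γ M)))
  inv := (⟨LinearMap.id, fun l _ h => M.mem_congr (add_assoc γ δ l).symm h⟩ :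
    Hom (shiftObj δ (shiftObj γ M)) (shiftObj (γ + δ) M))

theorem eqToHom_apply {γ δ : Γ} (h : γ = δ) (M : GrMod.{w} 𝒜)
    (h' : (shift γ).obj M = (shift δ).obj M) (m : M.carrier) :
    Hom.toLinearMap (eqToHom h') m = m := by
  subst h
  rfl

/-- The category `Gr-A` with the shifts by the elements of `Γ`; all the structure isomorphisms are
identity maps on the underlying modules. -/
instance : HasShift (GrMod.{w} 𝒜) Γ := hasShiftMk _ _
  { F := shift
    zero := NatIso.ofComponents shiftZeroIso
    add := fun γ δ => NatIso.ofComponents (shiftAddIso γ δ)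
    assoc_hom_app := fun a b c M => by
      apply hom_ext; apply LinearMap.ext; intro m
      exact (eqToHom_apply (add_assoc a b c) M _ m).symm
    zero_add_hom_app := fun a M => by
      apply hom_ext; apply LinearMap.ext; intro m
      exact (eqToHom_apply (zero_add a) M _ m).symm
    add_zero_hom_app := fun a M => by
      apply hom_ext; apply LinearMap.ext; intro m
      exact (eqToHom_apply (add_zero a) M _ m).symm }

end GrMod

/-- Two `Γ`-graded unital rings are graded Morita equivalent if there is a graded equivalence
`Gr-A ≌ Gr-B`, that is, an equivalence of categories that commutes with all the shifts (up to
natural isomorphisms compatible with the composition of shifts). -/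
def GradedMoritaEquivalent {A : Type u} {B : Type v} [Ring A] [Ring B]
    (𝒜 : Γ → AddSubgroup A) [GradedRing 𝒜] (ℬ : Γ → AddSubgroup B) [GradedRing ℬ] : Prop :=
  ∃ F : GrMod.{max u v} 𝒜 ⥤ GrMod.{max u v} ℬ, F.IsEquivalence ∧ Nonempty (F.CommShift Γ)

end GrMod

/-! ### Exchange endomorphism rings in a preadditive category. -/

section Exchange

/-! `EpsilonExchange` says that the regular module has an exchange endomorphism ring in the graded
module category (`epsilonExchange_iff`). Call an object good if its endomorphism ring is exchange.
Good objects are closed under binary biproducts (`isExchangeRing_end_of_binaryBicone`), retracts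
(`isExchangeRing_end_of_retract`), shifts, and full additive functors.

Let `F` be an equivalence and let `A` be good. The shifts of `A` generate its category, so their
images under `F`, which are good, generate the other one. Hence every `N` there is covered by images
of good objects: `exchangeTrace N` is everything (`exchangeTrace_eq_top_of_isEquivalence`). For `N =
B`, closure under biproducts puts `1` in the image of a single morphism from a good `X`. The
degree-zero part of a preimage of `1` splits this morphism, so `B` is a retract of `X` and is good.
The inverse of `F` gives the converse. -/

theorem IsExchangeRing.of_surjective {R S : Type*} [Ring R] [Ring S] (h : IsExchangeRing R)
    (φ : R →+* S) (hφ : Function.Surjective φ) : IsExchangeRing S := by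
  intro y
  obtain ⟨x, rfl⟩ := hφ y
  obtain ⟨e, he, ⟨r, hr⟩, s, hs⟩ := h x
  refine ⟨φ e, he.map φ, ⟨φ r, ?_⟩, φ s, ?_⟩
  · rw [hr, map_mul]
  · rw [← map_one φ, ← map_sub, hs, map_mul, map_sub]

/-- `1 = a + b` splits over `e` if there are orthogonal idempotents `a * r` and `b * s` whose sum
agrees with `e` after projecting to the corner `e`. -/
structure SplitsOver {R : Type*} [Ring R] (a b e r s : R) : Prop where
  right_mul : r * e = r
  right_mul' : s * e = s
  mul_mul : r * a * r = r
  mul_mul' : s * b * s = s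
  mul_mul_eq_zero : r * b * s = 0
  mul_mul_eq_zero' : s * a * r = 0
  add_eq : e * a * r + e * b * s = e

/-- If `1 = a + b` splits over an idempotent `e`, with sum of idempotents `u`, and over `1 - u`, then
there is an idempotent in `aR` whose complement is in `bR`. -/
theorem SplitsOver.exists_isIdempotentElem {R : Type*} [Ring R] {a b e r s r' s' : R}
    (h : SplitsOver a b e r s) (h' : SplitsOver a b (1 - (a * r + b * s)) r' s') :
    ∃ g : R, IsIdempotentElem g ∧ (∃ x, g = a * x) ∧ ∃ y, 1 - g = b * y := by
  set u := a * r + b * s with hu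
  set t := a * r' with ht
  set v := b * s' with hv
  set p := a * r with hp
  set q := b * s with hq
  set w := 1 - u with hw
  have hpp : p * p = p := by
    rw [hp, mul_assoc, ← mul_assoc r a r, h.mul_mul]
  have hqq : q * q = q := by
    rw [hq, mul_assoc, ← mul_assoc s b s, h.mul_mul']
  have hpq : p * q = 0 := by
    rw [hp, hq, mul_assoc, ← mul_assoc r b s, h.mul_mul_eq_zero, mul_zero]
  have hqp : q * p = 0 := by
    rw [hp, hq, mul_assoc, ← mul_assoc s a r, h.mul_mul_eq_zero', mul_zero]
  have hwp : w * p = 0 := by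
    rw [hw, sub_mul, one_mul, hu, add_mul, hpp, hqp, add_zero, sub_self]
  have hwq : w * q = 0 := by
    rw [hw, sub_mul, one_mul, hu, add_mul, hqq, hpq, zero_add, sub_self]
  have htw : t * w = t := by rw [ht, mul_assoc, h'.right_mul]
  have hvw : v * w = v := by rw [hv, mul_assoc, h'.right_mul']
  have htt : t * t = t := by
    rw [ht, mul_assoc, ← mul_assoc r' a r', h'.mul_mul]
  have hvv : v * v = v := by
    rw [hv, mul_assoc, ← mul_assoc s' b s', h'.mul_mul']
  have htv : t * v = 0 := by
    rw [ht, hv, mul_assoc, ← mul_assoc r' b s', h'.mul_mul_eq_zero, mul_zero]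
  have hvt : v * t = 0 := by
    rw [ht, hv, mul_assoc, ← mul_assoc s' a r', h'.mul_mul_eq_zero', mul_zero]
  have hadd : w * t + w * v = w := by
    rw [ht, hv, ← mul_assoc, ← mul_assoc]; exact h'.add_eq
  have hsum : p + q = u := hu.symm
  have huw : u = 1 - w := by rw [hw]; abel
  clear_value u t v p q w
  -- `t` and `v` vanish on the image of `u` but need not map into that of `w`; `n` is the error. It
  -- squares to zero, and the unit `1 + n` carries the complementary idempotents `p + w * t`, `q + w
  -- * v` to `p + t` in `aR` and `q + v` in `bR`. Conjugation by it gives the required idempotent.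
  obtain ⟨n, hn⟩ : ∃ n, n = u * (t + v) := ⟨_, rfl⟩
  have hnw : n * w = n := by rw [hn, mul_assoc, add_mul, htw, hvw]
  have hnu : n * u = 0 := by rw [huw, mul_sub, mul_one, hnw, sub_self]
  have hnn : n * n = 0 := by
    nth_rewrite 2 [hn]
    rw [← mul_assoc, hnu, zero_mul]
  have hnp : n * p = 0 := by rw [← hnw, mul_assoc, hwp, mul_zero]
  have hnq : n * q = 0 := by rw [← hnw, mul_assoc, hwq, mul_zero]
  have hnt : n * (w * t) = u * t := by
    rw [← mul_assoc, hnw, hn, mul_assoc, add_mul, htt, hvt, add_zero]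
  have hnv : n * (w * v) = u * v := by
    rw [← mul_assoc, hnw, hn, mul_assoc, add_mul, hvv, htv, zero_add]
  have hSa : (1 + n) * (p + w * t) = p + t := by
    rw [add_mul, one_mul, mul_add, hnp, hnt, huw, sub_mul, one_mul]; abel
  have hSb : (1 + n) * (q + w * v) = q + v := by
    rw [add_mul, one_mul, mul_add, hnq, hnv, huw, sub_mul, one_mul]; abel
  have hS : (1 + n) * (1 - n) = 1 := by
    simp only [mul_sub, add_mul, one_mul, mul_one, hnn]; abel
  have hS' : (1 - n) * (1 + n) = 1 := by
    simp only [mul_add, sub_mul, one_mul, mul_one, hnn]; abel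
  have hid : (p + w * t) * (p + w * t) = p + w * t := by
    have h1 : p * (w * t) = 0 := by
      have : p * w = 0 := by rw [hw, hu, mul_sub, mul_add, hpp, hpq, mul_one, add_zero, sub_self]
      rw [← mul_assoc, this, zero_mul]
    have h2 : w * t * p = 0 := by
      rw [← htw, mul_assoc, mul_assoc, hwp, mul_zero, mul_zero]
    have h3 : w * t * (w * t) = w * t := by
      rw [mul_assoc, ← mul_assoc t w t, htw, htt]
    rw [mul_add, add_mul, add_mul, hpp, h1, h2, h3, zero_add, add_zero]
  have hone : (p + w * t) + (q + w * v) = 1 := by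
    rw [add_add_add_comm, hadd, hsum, hw]; abel
  refine ⟨(1 + n) * (p + w * t) * (1 - n), ?_, ⟨(r + r') * (1 - n), ?_⟩,
    (s + s') * (1 - n), ?_⟩
  · calc (1 + n) * (p + w * t) * (1 - n) * ((1 + n) * (p + w * t) * (1 - n))
        = (1 + n) * (p + w * t) * ((1 - n) * (1 + n)) * (p + w * t) * (1 - n) := by
          simp only [mul_assoc]
      _ = (1 + n) * ((p + w * t) * (p + w * t)) * (1 - n) := by
          rw [hS', mul_one, mul_assoc (1 + n)]
      _ = _ := by rw [hid]
  · rw [hSa, ← mul_assoc, mul_add, ← hp, ← ht]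
  · rw [← mul_assoc, mul_add b, ← hq, ← hv, ← hSb, sub_eq_iff_eq_add', ← add_mul, ← mul_add, hone,
      mul_one, hS]

variable {C : Type*} [Category* C] [Preadditive C]

/-- The compressions of `a` and `b` to `X` sum to `1`, so the exchange property gives `g = c a * ρ`
and `1 - g = c b * σ`. The witnesses are `ρ * g` and `σ * (1 - g)`, carried back to `Z`: the extra
idempotent factors make the products orthogonal. -/
theorem SplitsOver.of_isExchangeRing_end {X Z : C} (hX : IsExchangeRing (End X)) (i : X ⟶ Z)
    (p : Z ⟶ X) (hip : i ≫ p = 𝟙 X) (a b : End Z) (hab : a + b = 1) :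
    ∃ r s : End Z, SplitsOver a b (p ≫ i : End Z) r s := by
  let c : End Z → End X := fun z => i ≫ z ≫ p
  have hc : c a + c b = 1 := by
    have : c a + c b = i ≫ (a + b) ≫ p := by
      simp only [c]
      erw [Preadditive.add_comp, Preadditive.comp_add]
    rw [this, hab]
    change i ≫ 𝟙 Z ≫ p = _
    rw [Category.id_comp, hip]; rfl
  obtain ⟨g, hg, ⟨ρ, hρ⟩, σ, hσ⟩ := hX (c a)
  rw [← hc, add_sub_cancel_left, hc] at hσ
  have hσ' : (1 - g) * (1 - g) = 1 - g := hg.one_sub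
  have hgh : g * (1 - g) = 0 := by rw [mul_sub, mul_one, hg.eq, sub_self]
  have hhg : (1 - g) * g = 0 := by rw [sub_mul, one_mul, hg.eq, sub_self]
  let l : End X → End Z := fun x => p ≫ x ≫ i
  have hll (x y : End X) : l x * l y = l (x * y) := by
    simp only [l, End.mul_def, Category.assoc]
    rw [reassoc_of% hip]
  have hlc (x y : End X) (z : End Z) : l x * z * l y = l (x * c z * y) := by
    simp only [l, c, End.mul_def, Category.assoc]
  have hl1 : (p ≫ i : End Z) = l 1 := by
    change _ = p ≫ 𝟙 X ≫ i
    rw [Category.id_comp]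
  have hladd (x y : End X) : l x + l y = l (x + y) := by
    simp only [l]
    erw [Preadditive.add_comp, Preadditive.comp_add]
  have hl0 : l 0 = 0 := by
    simp only [l]
    erw [Limits.zero_comp, Limits.comp_zero]
  rw [hl1]
  refine ⟨l (ρ * g), l (σ * (1 - g)), ?_, ?_, ?_, ?_, ?_, ?_, ?_⟩
  · rw [hll, mul_one]
  · rw [hll, mul_one]
  · rw [hlc, mul_assoc, ← mul_assoc (c a), ← hρ, hg.eq, mul_assoc, hg.eq]
  · rw [hlc, mul_assoc, ← mul_assoc (c b), ← hσ, hσ', mul_assoc, hσ']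
  · rw [hlc, mul_assoc, ← mul_assoc (c b), ← hσ, hσ', mul_assoc, hgh, mul_zero, hl0]
  · rw [hlc, mul_assoc, ← mul_assoc (c a), ← hρ, hg.eq, mul_assoc, hhg, mul_zero, hl0]
  · rw [hlc, hlc, hladd, one_mul, one_mul, ← mul_assoc, ← mul_assoc, ← hρ, ← hσ, hg.eq, hσ']
    congr 1
    abel

/-- Splitting over the summand `X` gives an idempotent `u` with the same kernel as `e`. Hence `w = 1
- u` has the same image as `1 - e`, namely `Y`, and the exchange property of `Y` splits `1` over
`w`. The two splittings are then glued. -/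
theorem isExchangeRing_end_of_binaryBicone {X Y : C} (hX : IsExchangeRing (End X))
    (hY : IsExchangeRing (End Y)) (Z : Limits.BinaryBicone X Y)
    (htotal : Z.fst ≫ Z.inl + Z.snd ≫ Z.inr = 𝟙 Z.pt) : IsExchangeRing (End Z.pt) := by
  intro a
  obtain ⟨r, s, h⟩ := SplitsOver.of_isExchangeRing_end hX Z.inl Z.fst Z.inl_fst a (1 - a)
    (add_sub_cancel _ _)
  set e : End Z.pt := Z.fst ≫ Z.inl with he
  set u : End Z.pt := a * r + (1 - a) * s with hu
  have heu : e * u = e := by rw [hu, mul_add, ← mul_assoc, ← mul_assoc]; exact h.add_eq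
  have hue : u * e = u := by rw [hu, add_mul, mul_assoc, mul_assoc, h.right_mul, h.right_mul']
  let f : End Z.pt := Z.snd ≫ Z.inr
  have hf : f = 1 - e := by
    rw [eq_sub_iff_add_eq']; exact htotal
  obtain ⟨w, hw⟩ : ∃ w : End Z.pt, w = 1 - u := ⟨_, rfl⟩
  have hwf : w * f = f := by
    rw [hw, hf, mul_sub, mul_one, sub_mul, one_mul, hue]; abel
  have hfw : f * w = w := by
    rw [hw, hf, sub_mul, one_mul, mul_sub, mul_one, heu]; abel
  have hinr : Z.inr ≫ w ≫ Z.snd = 𝟙 Y := by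
    have h1 : Z.inr ≫ (Z.snd ≫ Z.inr) ≫ w ≫ Z.snd = Z.inr ≫ (Z.snd ≫ Z.inr) ≫ Z.snd := by
      rw [← Category.assoc (Z.snd ≫ Z.inr)]
      exact congrArg (fun x => Z.inr ≫ x ≫ Z.snd) hwf
    simpa using h1
  obtain ⟨r', s', h'⟩ := SplitsOver.of_isExchangeRing_end hY Z.inr (w ≫ Z.snd) hinr a (1 - a)
    (add_sub_cancel _ _)
  have hw' : (w ≫ Z.snd) ≫ Z.inr = w := by
    rw [Category.assoc]; exact hfw
  rw [hw', hw] at h'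
  exact h.exists_isIdempotentElem h'

theorem isExchangeRing_end_of_retract {X Z : C} (hX : IsExchangeRing (End X)) (i : Z ⟶ X)
    (p : X ⟶ Z) (hip : i ≫ p = 𝟙 Z) : IsExchangeRing (End Z) := by
  intro (z : Z ⟶ Z)
  obtain ⟨g, hg', ⟨r, hr'⟩, s, hs'⟩ : ∃ g : X ⟶ X, g ≫ g = g ∧
      (∃ r : X ⟶ X, g = r ≫ p ≫ z ≫ i) ∧ ∃ s : X ⟶ X, 𝟙 X - g = s ≫ (𝟙 X - p ≫ z ≫ i) :=
    hX (p ≫ z ≫ i)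
  -- By its factorization, `g` lands in the summand `Z`; this makes its compression to `Z`
  -- idempotent.
  have hgp : g ≫ p ≫ i = g := by
    nth_rewrite 1 [hr']
    simp only [Category.assoc, reassoc_of% hip]
    exact hr'.symm
  refine ⟨i ≫ g ≫ p, ?_, ⟨i ≫ r ≫ p, ?_⟩, i ≫ s ≫ p, ?_⟩
  · change (i ≫ g ≫ p) ≫ i ≫ g ≫ p = i ≫ g ≫ p
    simp only [Category.assoc]
    rw [reassoc_of% hgp, reassoc_of% hg']
  · change _ = (i ≫ r ≫ p) ≫ z
    rw [hr']
    simp [hip]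
  · change 𝟙 Z - i ≫ g ≫ p = (i ≫ s ≫ p) ≫ (𝟙 Z - z)
    have h1 : i ≫ (𝟙 X - g) ≫ p = i ≫ (s ≫ (𝟙 X - p ≫ z ≫ i)) ≫ p := by rw [hs']
    simp only [Preadditive.sub_comp, Preadditive.comp_sub, Category.assoc, hip,
      Category.id_comp, Category.comp_id] at h1 ⊢
    exact h1

variable {D : Type*} [Category* D] [Preadditive D]

theorem isExchangeRing_end_obj (F : C ⥤ D) [F.Additive] [F.Full] {X : C}
    (hX : IsExchangeRing (End X)) : IsExchangeRing (End (F.obj X)) :=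
  hX.of_surjective
    { toFun := fun f => F.map f
      map_one' := F.map_id X
      map_mul' := fun f g => F.map_comp g f
      map_zero' := F.map_zero X X
      map_add' := fun _ _ => F.map_add }
    F.map_surjective

end Exchange

/-! ### Recognizing an internal grading by its projections. -/

section Internal

variable {Γ : Type*} [DecidableEq Γ] {M : Type*} [AddCommGroup M]

theorem isInternal_of_projections {ℳ : Γ → AddSubgroup M} (p : Γ → M →+ M)
    (hp : ∀ γ, ∀ m ∈ ℳ γ, p γ m = m) (hp' : ∀ γ δ, γ ≠ δ → ∀ m ∈ ℳ δ, p γ m = 0)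
    (htop : ∀ m, m ∈ ⨆ γ, ℳ γ) : DirectSum.IsInternal ℳ := by
  constructor
  · refine (injective_iff_map_eq_zero _).2 fun x hx => ?_
    have key : ∀ (y : DirectSum Γ fun γ => ℳ γ) (γ : Γ),
        p γ (DirectSum.coeAddMonoidHom ℳ y) = y γ := by
      intro y γ
      induction y using DirectSum.induction_on with
      | zero => simp
      | add x y hx hy => simp [hx, hy]
      | of δ y =>
        rw [DirectSum.coeAddMonoidHom_of]
        by_cases h : δ = γ
        · subst h
          rw [hp δ _ y.2, DirectSum.of_eq_same]
        · rw [hp' γ δ (Ne.symm h) _ y.2, DirectSum.of_eq_of_ne _ _ _ (Ne.symm h)]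
          rfl
    ext γ
    rw [← key, hx, map_zero]
    rfl
  · intro m
    induction htop m using AddSubgroup.iSup_induction' with
    | hp γ x hx => exact ⟨DirectSum.of (fun γ => ℳ γ) γ ⟨x, hx⟩, DirectSum.coeAddMonoidHom_of _ _ _⟩
    | h1 => exact ⟨0, map_zero _⟩
    | hadd x y _ _ hx hy =>
      obtain ⟨a, rfl⟩ := hx
      obtain ⟨b, rfl⟩ := hy
      exact ⟨a + b, map_add _ _ _⟩

end Internal

/-! ### Additive structure of the graded module category. -/

namespace GrMod

variable {Γ : Type*} [AddGroup Γ] [DecidableEq Γ] {A : Type u} [Ring A]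
  {𝒜 : Γ → AddSubgroup A} [GradedRing 𝒜]

theorem induction_on_components (M : GrMod.{w} 𝒜) {P : M.carrier → Prop} (m : M.carrier)
    (zero : P 0) (homogeneous : ∀ γ, ∀ m ∈ M.component γ, P m)
    (add : ∀ m n, P m → P n → P (m + n)) : P m := by
  obtain ⟨x, rfl⟩ := M.isInternal.2 m
  induction x using DirectSum.induction_on with
  | zero => rwa [map_zero]
  | add x y hx hy => rw [map_add]; exact add _ _ hx hy
  | of γ x => rw [DirectSum.coeAddMonoidHom_of]; exact homogeneous γ _ x.2

theorem hom_ext_of_homogeneous {M N : GrMod.{w} 𝒜} {f g : M ⟶ N}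
    (h : ∀ γ, ∀ m ∈ M.component γ, f.toLinearMap m = g.toLinearMap m) : f = g := by
  apply hom_ext
  ext m
  induction m using M.induction_on_components with
  | zero => simp
  | homogeneous γ m hm => exact h γ m hm
  | add m n hm hn => simp [hm, hn]

/-- The projection of a graded module to one of its components. -/
noncomputable def proj (M : GrMod.{w} 𝒜) (γ : Γ) : M.carrier →+ M.carrier :=
  ((M.component γ).subtype.comp (DFinsupp.evalAddMonoidHom γ)).comp
    (AddEquiv.ofBijective _ M.isInternal).symm.toAddMonoidHom

theorem proj_mem (M : GrMod.{w} 𝒜) (γ : Γ) (m : M.carrier) : M.proj γ m ∈ M.component γ :=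
  Subtype.property _

theorem ofBijective_symm_of_mem (M : GrMod.{w} 𝒜) {γ : Γ} {m : M.carrier}
    (hm : m ∈ M.component γ) : (AddEquiv.ofBijective _ M.isInternal).symm m =
      DirectSum.of (fun γ => M.component γ) γ ⟨m, hm⟩ := by
  rw [AddEquiv.symm_apply_eq]
  exact (DirectSum.coeAddMonoidHom_of M.component γ ⟨m, hm⟩).symm

theorem proj_of_mem (M : GrMod.{w} 𝒜) (γ : Γ) (m : M.carrier) (hm : m ∈ M.component γ) :
    M.proj γ m = m := by
  change (((AddEquiv.ofBijective _ M.isInternal).symm m) γ : M.carrier) = m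
  rw [M.ofBijective_symm_of_mem hm, DirectSum.of_eq_same]

theorem proj_of_mem_ne (M : GrMod.{w} 𝒜) (γ δ : Γ) (h : γ ≠ δ) (m : M.carrier)
    (hm : m ∈ M.component δ) : M.proj γ m = 0 := by
  change (((AddEquiv.ofBijective _ M.isInternal).symm m) γ : M.carrier) = 0
  rw [M.ofBijective_symm_of_mem hm, DirectSum.of_eq_of_ne _ _ _ h]
  rfl

theorem map_proj {M N : GrMod.{w} 𝒜} (f : M ⟶ N) (γ : Γ) (m : M.carrier) :
    f.toLinearMap (M.proj γ m) = N.proj γ (f.toLinearMap m) := by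
  induction m using M.induction_on_components with
  | zero => simp
  | homogeneous δ m hm =>
    by_cases h : γ = δ
    · subst h
      rw [M.proj_of_mem _ _ hm, N.proj_of_mem _ _ (f.map_mem _ _ hm)]
    · rw [M.proj_of_mem_ne _ _ h _ hm, N.proj_of_mem_ne _ _ h _ (f.map_mem _ _ hm), map_zero]
  | add m n hm hn => simp [hm, hn]

section Preadditive

variable {M N : GrMod.{w} 𝒜}

theorem toLinearMap_injective :
    Function.Injective (Hom.toLinearMap : (M ⟶ N) → (M.carrier →ₗ[Aᵐᵒᵖ] N.carrier)) :=
  fun _ _ h => hom_ext h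

instance : Zero (M ⟶ N) := ⟨(⟨0, fun γ _ _ => zero_mem (N.component γ)⟩ : Hom M N)⟩

instance : Add (M ⟶ N) := ⟨fun f g => (⟨f.toLinearMap + g.toLinearMap,
  fun γ m hm => add_mem (f.map_mem γ m hm) (g.map_mem γ m hm)⟩ : Hom M N)⟩

instance : Neg (M ⟶ N) := ⟨fun f => (⟨-f.toLinearMap,
  fun γ m hm => neg_mem (f.map_mem γ m hm)⟩ : Hom M N)⟩

instance : Sub (M ⟶ N) := ⟨fun f g => (⟨f.toLinearMap - g.toLinearMap,
  fun γ m hm => sub_mem (f.map_mem γ m hm) (g.map_mem γ m hm)⟩ : Hom M N)⟩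

instance : SMul ℕ (M ⟶ N) := ⟨fun k f => (⟨k • f.toLinearMap,
  fun γ m hm => nsmul_mem (f.map_mem γ m hm) k⟩ : Hom M N)⟩

instance : SMul ℤ (M ⟶ N) := ⟨fun k f => (⟨k • f.toLinearMap,
  fun γ m hm => zsmul_mem (f.map_mem γ m hm) k⟩ : Hom M N)⟩

instance : AddCommGroup (M ⟶ N) :=
  Function.Injective.addCommGroup (M₁ := (M ⟶ N)) (fun f => Hom.toLinearMap f)
    toLinearMap_injective rfl (fun _ _ => rfl) (fun _ => rfl) (fun _ _ => rfl)
    (fun _ _ => rfl) (fun _ _ => rfl)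

@[simp]
theorem add_toLinearMap (f g : M ⟶ N) :
    Hom.toLinearMap (f + g) = f.toLinearMap + g.toLinearMap := rfl

@[simp]
theorem zero_toLinearMap : Hom.toLinearMap (0 : M ⟶ N) = 0 := rfl

instance : Preadditive (GrMod.{w} 𝒜) where
  add_comp _ _ _ f f' g := by
    apply hom_ext; ext m; simp
  comp_add _ _ _ f g g' := by
    apply hom_ext; ext m; simp

end Preadditive

/-- The direct sum of two graded modules. -/
def prod (M N : GrMod.{w} 𝒜) : GrMod.{w} 𝒜 where
  carrier := M.carrier × N.carrier
  component γ := (M.component γ).prod (N.component γ)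
  isInternal := by
    refine isInternal_of_projections
      (fun γ => AddMonoidHom.prodMap (M.proj γ) (N.proj γ)) ?_ ?_ ?_
    · rintro γ ⟨m, n⟩ ⟨hm, hn⟩
      exact Prod.ext (M.proj_of_mem γ m hm) (N.proj_of_mem γ n hn)
    · rintro γ δ h ⟨m, n⟩ ⟨hm, hn⟩
      exact Prod.ext (M.proj_of_mem_ne γ δ h m hm) (N.proj_of_mem_ne γ δ h n hn)
    · rintro ⟨m, n⟩
      rw [← Prod.fst_add_snd (m, n)]
      refine add_mem ?_ ?_
      · induction m using M.induction_on_components with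
        | zero => exact zero_mem _
        | homogeneous γ m hm => exact AddSubgroup.mem_iSup_of_mem γ ⟨hm, zero_mem _⟩
        | add m m' hm hm' => simpa using add_mem hm hm'
      · induction n using N.induction_on_components with
        | zero => exact zero_mem _
        | homogeneous γ n hn => exact AddSubgroup.mem_iSup_of_mem γ ⟨zero_mem _, hn⟩
        | add n n' hn hn' => simpa using add_mem hn hn'
  smul_mem γ δ m a hm ha := ⟨M.smul_mem γ δ _ a hm.1 ha, N.smul_mem γ δ _ a hm.2 ha⟩

/-- The direct sum of two graded modules, as a bicone. -/
def binaryBicone (M N : GrMod.{w} 𝒜) : Limits.BinaryBicone M N where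
  pt := M.prod N
  fst := (⟨LinearMap.fst _ _ _, fun _ _ hm => hm.1⟩ : Hom (M.prod N) M)
  snd := (⟨LinearMap.snd _ _ _, fun _ _ hm => hm.2⟩ : Hom (M.prod N) N)
  inl := (⟨LinearMap.inl _ _ _, fun _ _ hm => ⟨hm, zero_mem _⟩⟩ : Hom M (M.prod N))
  inr := (⟨LinearMap.inr _ _ _, fun _ _ hm => ⟨zero_mem _, hm⟩⟩ : Hom N (M.prod N))
  inl_fst := hom_ext (LinearMap.fst_comp_inl _ _ _)
  inl_snd := hom_ext (LinearMap.snd_comp_inl _ _ _)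
  inr_fst := hom_ext (LinearMap.fst_comp_inr _ _ _)
  inr_snd := hom_ext (LinearMap.snd_comp_inr _ _ _)

theorem binaryBicone_total (M N : GrMod.{w} 𝒜) :
    (M.binaryBicone N).fst ≫ (M.binaryBicone N).inl +
      (M.binaryBicone N).snd ≫ (M.binaryBicone N).inr = 𝟙 (M.binaryBicone N).pt := by
  apply hom_ext
  apply LinearMap.ext
  intro m
  exact Prod.fst_add_snd (show M.carrier × N.carrier from m)

instance : Limits.HasBinaryBiproducts (GrMod.{w} 𝒜) where
  has_binary_biproduct M N :=
    Limits.hasBinaryBiproduct_of_total (M.binaryBicone N) (M.binaryBicone_total N)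

/-- Addition of morphisms is determined by biproducts, and equivalences preserve products. -/
theorem additive_of_isEquivalence {B : Type v} [Ring B] {ℬ : Γ → AddSubgroup B} [GradedRing ℬ]
    (F : GrMod.{w} 𝒜 ⥤ GrMod.{w} ℬ) [F.IsEquivalence] : F.Additive :=
  F.additive_of_preserves_binary_products

end GrMod

/-! ### The regular module, its shifts and the exchange trace. -/

namespace GrMod

variable {Γ : Type*} [AddGroup Γ] [DecidableEq Γ] {A : Type u} [Ring A]

section Regular

variable (𝒜 : Γ → AddSubgroup A) [GradedRing 𝒜]

/-- The graded ring `A` as a graded right module over itself, in a larger universe. -/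
def regular : GrMod.{max u w} 𝒜 where
  carrier := ULift.{w} A
  component γ := (𝒜 γ).comap (AddEquiv.ulift : ULift.{w} A ≃+ A).toAddMonoidHom
  isInternal := by
    refine isInternal_of_projections (fun γ =>
      (AddEquiv.ulift.symm.toAddMonoidHom.comp (GradedRing.proj 𝒜 γ)).comp
        (AddEquiv.ulift : ULift.{w} A ≃+ A).toAddMonoidHom) ?_ ?_ ?_
    · rintro γ ⟨m⟩ (hm : m ∈ 𝒜 γ)
      exact congrArg ULift.up (DirectSum.decompose_of_mem_same 𝒜 hm)
    · rintro γ δ h ⟨m⟩ (hm : m ∈ 𝒜 δ)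
      exact congrArg ULift.up (DirectSum.decompose_of_mem_ne 𝒜 hm (Ne.symm h))
    · rintro ⟨m⟩
      induction m using DirectSum.Decomposition.inductionOn 𝒜 with
      | zero => exact zero_mem _
      | homogeneous m => exact AddSubgroup.mem_iSup_of_mem _ m.2
      | add m n hm hn => exact add_mem hm hn
  smul_mem γ δ m a hm ha := SetLike.mul_mem_graded (A := 𝒜) (show m.down ∈ 𝒜 γ from hm) ha

/-- The identity of `A`, as an element of the regular module. -/
def regularOne : (regular.{w} 𝒜).carrier := ULift.up 1

theorem exists_smul_regularOne (m : (regular.{w} 𝒜).carrier) :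
    ∃ a : Aᵐᵒᵖ, a • regularOne.{w} 𝒜 = m :=
  ⟨MulOpposite.op (ULift.down.{w} m), ULift.ext _ _ (one_mul (ULift.down.{w} m))⟩

/-- The endomorphisms of the graded module `A`, as those of its lift to a larger universe. -/
def gradedEndZeroEquiv : gradedEndZero A 𝒜 ≃+* End (regular.{w} 𝒜) where
  toFun f := (⟨(ULift.moduleEquiv.symm.toLinearMap.comp f.1.1).comp ULift.moduleEquiv.toLinearMap,
    fun γ m hm => by
      have h := f.2 γ m.down hm
      rw [zero_add] at h
      exact h⟩ : Hom (regular.{w} 𝒜) (regular.{w} 𝒜))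
  invFun f :=
    let g : A →ₗ[Aᵐᵒᵖ] A := (ULift.moduleEquiv.toLinearMap.comp
      (show ULift.{w} A →ₗ[Aᵐᵒᵖ] ULift.{w} A from Hom.toLinearMap f)).comp
        ULift.moduleEquiv.symm.toLinearMap
    have hg : g ∈ homOfDegree (A := A) 𝒜 𝒜 0 := fun γ m hm => by
      rw [zero_add]
      exact Hom.map_mem f γ ⟨m⟩ hm
    ⟨⟨g, AddSubgroup.mem_iSup_of_mem 0 hg⟩, hg⟩
  left_inv _ := rfl
  right_inv _ := rfl
  map_mul' _ _ := rfl
  map_add' _ _ := rfl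

theorem epsilonExchange_iff : EpsilonExchange 𝒜 ↔ IsExchangeRing (End (regular.{w} 𝒜)) :=
  ⟨fun h => h.of_surjective (gradedEndZeroEquiv 𝒜).toRingHom (gradedEndZeroEquiv 𝒜).surjective,
    fun h => h.of_surjective (gradedEndZeroEquiv 𝒜).symm.toRingHom
      (gradedEndZeroEquiv 𝒜).symm.surjective⟩

end Regular

variable {𝒜 : Γ → AddSubgroup A} [GradedRing 𝒜]

/-- The morphism `(-γ)A ⟶ M` sending `1` to the element `m` of degree `γ`. -/
def ofHomogeneous (M : GrMod.{max u w} 𝒜) (γ : Γ) (m : M.carrier) (hm : m ∈ M.component γ) :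
    (shift (-γ)).obj (regular.{w} 𝒜) ⟶ M :=
  (⟨{ toFun := fun a => MulOpposite.op (ULift.down.{w} a) • m
      map_add' := fun a b => add_smul (MulOpposite.op (ULift.down.{w} a))
        (MulOpposite.op (ULift.down.{w} b)) m
      map_smul' := fun c a => mul_smul c (MulOpposite.op (ULift.down.{w} a)) m },
    fun δ a ha => by
      have h := M.smul_mem γ (-γ + δ) m (ULift.down.{w} a) hm ha
      rwa [add_neg_cancel_left] at h⟩ :
    Hom ((shift (-γ)).obj (regular.{w} 𝒜)) M)

theorem ofHomogeneous_one (M : GrMod.{max u w} 𝒜) (γ : Γ) (m : M.carrier)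
    (hm : m ∈ M.component γ) :
    (ofHomogeneous.{w} M γ m hm).toLinearMap (regularOne.{w} 𝒜) = m :=
  one_smul Aᵐᵒᵖ m

theorem one_mem_regular_zero : regularOne.{w} 𝒜 ∈ (regular.{w} 𝒜).component 0 :=
  SetLike.GradedOne.one_mem (A := 𝒜)

/-- The morphism `A ⟶ M` sending `1` to the element `m` of degree zero. -/
def ofDegreeZero (M : GrMod.{max u w} 𝒜) (m : M.carrier) (hm : m ∈ M.component 0) :
    regular.{w} 𝒜 ⟶ M :=
  (⟨{ toFun := fun a => MulOpposite.op (ULift.down.{w} a) • m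
      map_add' := fun a b => add_smul (MulOpposite.op (ULift.down.{w} a))
        (MulOpposite.op (ULift.down.{w} b)) m
      map_smul' := fun c a => mul_smul c (MulOpposite.op (ULift.down.{w} a)) m },
    fun δ a ha => by
      have h := M.smul_mem 0 δ m (ULift.down.{w} a) hm ha
      rwa [zero_add] at h⟩ :
    Hom (regular.{w} 𝒜) M)

theorem ofDegreeZero_one (M : GrMod.{max u w} 𝒜) (m : M.carrier) (hm : m ∈ M.component 0) :
    (ofDegreeZero.{w} M m hm).toLinearMap (regularOne.{w} 𝒜) = m :=
  one_smul Aᵐᵒᵖ m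

theorem regular_hom_ext {M : GrMod.{max u w} 𝒜} {f g : regular.{w} 𝒜 ⟶ M}
    (h : f.toLinearMap (regularOne.{w} 𝒜) = g.toLinearMap (regularOne.{w} 𝒜)) : f = g := by
  apply hom_ext
  apply LinearMap.ext
  intro a
  obtain ⟨a, rfl⟩ := exists_smul_regularOne 𝒜 a
  rw [map_smul, map_smul, h]

theorem isExchangeRing_end_shift (M : GrMod.{w} 𝒜) (γ : Γ) (h : IsExchangeRing (End M)) :
    IsExchangeRing (End ((shift γ).obj M)) :=
  h.of_surjective
    { toFun := fun f => (shift γ).map f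
      map_one' := rfl
      map_mul' := fun _ _ => rfl
      map_zero' := rfl
      map_add' := fun _ _ => rfl } fun f =>
    let g : Hom (shiftObj γ M) (shiftObj γ M) := f
    ⟨(⟨g.toLinearMap, fun δ m hm => by
      have h := g.map_mem (-γ + δ) m (M.mem_congr (add_neg_cancel_left γ δ).symm hm)
      exact M.mem_congr (add_neg_cancel_left γ δ) h⟩ : Hom M M), rfl⟩

/-- The quotient of a graded module by a homogeneous submodule. -/
def quotient (M : GrMod.{w} 𝒜) (I : Submodule Aᵐᵒᵖ M.carrier)
    (hI : ∀ γ, ∀ m ∈ I, M.proj γ m ∈ I) : GrMod.{w} 𝒜 where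
  carrier := M.carrier ⧸ I
  component γ := (M.component γ).map I.mkQ.toAddMonoidHom
  isInternal := by
    refine isInternal_of_projections
      (fun γ => QuotientAddGroup.map I.toAddSubgroup I.toAddSubgroup (M.proj γ) (hI γ)) ?_ ?_ ?_
    · rintro γ _ ⟨m, hm, rfl⟩
      exact congrArg I.mkQ (M.proj_of_mem γ m hm)
    · rintro γ δ h _ ⟨m, hm, rfl⟩
      exact (congrArg I.mkQ (M.proj_of_mem_ne γ δ h m hm)).trans (map_zero _)
    · intro m
      obtain ⟨m, rfl⟩ := I.mkQ_surjective m
      induction m using M.induction_on_components with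
      | zero => rw [map_zero]; exact zero_mem _
      | homogeneous γ m hm => exact AddSubgroup.mem_iSup_of_mem γ ⟨m, hm, rfl⟩
      | add m n hm hn => rw [map_add]; exact add_mem hm hn
  smul_mem := by
    rintro γ δ _ a ⟨m, hm, rfl⟩ ha
    exact ⟨MulOpposite.op a • m, M.smul_mem γ δ m a hm ha, map_smul I.mkQ _ _⟩

/-- The canonical morphism to the quotient by a homogeneous submodule. -/
def toQuotient (M : GrMod.{w} 𝒜) (I : Submodule Aᵐᵒᵖ M.carrier)
    (hI : ∀ γ, ∀ m ∈ I, M.proj γ m ∈ I) : M ⟶ M.quotient I hI :=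
  (⟨I.mkQ, fun _ m hm => ⟨m, hm, rfl⟩⟩ : Hom M (M.quotient I hI))

theorem exists_isExchangeRing_end (𝒜 : Γ → AddSubgroup A) [GradedRing 𝒜] (M : GrMod.{w} 𝒜) :
    ∃ X : GrMod.{w} 𝒜, IsExchangeRing (End X) := by
  -- This quotient is the zero module.
  refine ⟨M.quotient ⊤ fun _ _ _ => trivial, fun x => ⟨0, IsIdempotentElem.zero, ⟨0, ?_⟩, 1, ?_⟩⟩
  · rw [mul_zero]
  · apply hom_ext
    apply LinearMap.ext
    intro m
    exact Subsingleton.elim (α := M.carrier ⧸ (⊤ : Submodule Aᵐᵒᵖ M.carrier)) _ _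

/-- The sum of the images of all morphisms to `M` from objects whose endomorphism ring is an
exchange ring. -/
def exchangeTrace (M : GrMod.{w} 𝒜) : Submodule Aᵐᵒᵖ M.carrier where
  carrier := {m | ∃ X : GrMod.{w} 𝒜, IsExchangeRing (End X) ∧
    ∃ (f : X ⟶ M) (x : X.carrier), f.toLinearMap x = m}
  zero_mem' := by
    obtain ⟨X, hX⟩ := exists_isExchangeRing_end 𝒜 M
    exact ⟨X, hX, 0, 0, rfl⟩
  add_mem' := by
    rintro _ _ ⟨X, hX, f, x, rfl⟩ ⟨Y, hY, g, y, rfl⟩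
    -- Closure under biproducts lets one source replace two, so single images already form a
    -- submodule.
    exact ⟨X.prod Y, isExchangeRing_end_of_binaryBicone hX hY _ (X.binaryBicone_total Y),
      (X.binaryBicone Y).fst ≫ f + (X.binaryBicone Y).snd ≫ g, (x, y), rfl⟩
  smul_mem' := by
    rintro c _ ⟨X, hX, f, x, rfl⟩
    exact ⟨X, hX, f, c • x, map_smul _ _ _⟩

theorem proj_mem_exchangeTrace (M : GrMod.{w} 𝒜) (γ : Γ) (m : M.carrier)
    (hm : m ∈ M.exchangeTrace) : M.proj γ m ∈ M.exchangeTrace := by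
  obtain ⟨X, hX, f, x, rfl⟩ := hm
  exact ⟨X, hX, f, X.proj γ x, map_proj f γ x⟩

theorem comp_toQuotient_exchangeTrace {X M : GrMod.{w} 𝒜} (hX : IsExchangeRing (End X))
    (f : X ⟶ M) : f ≫ M.toQuotient M.exchangeTrace M.proj_mem_exchangeTrace = 0 := by
  apply hom_ext
  apply LinearMap.ext
  intro x
  exact (Submodule.Quotient.mk_eq_zero _).2 ⟨X, hX, f, x, rfl⟩

variable {B : Type v} [Ring B] {ℬ : Γ → AddSubgroup B} [GradedRing ℬ]

/-- It suffices that the projection `π` modulo the trace vanishes, and `F.inv` is faithful.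
`F.inv.map π` is tested on morphisms from shifts of `A`; transported by `F` and the counit, these
become morphisms from good objects to `N`, which `π` kills. -/
theorem exchangeTrace_eq_top_of_isEquivalence (F : GrMod.{max u w} 𝒜 ⥤ GrMod.{max u w} ℬ)
    [F.IsEquivalence] (h : IsExchangeRing (End (regular.{w} 𝒜))) (N : GrMod.{max u w} ℬ) :
    N.exchangeTrace = ⊤ := by
  have : F.Additive := additive_of_isEquivalence F
  let π := N.toQuotient N.exchangeTrace N.proj_mem_exchangeTrace
  have hπ : F.inv.map π = 0 := by
    apply hom_ext_of_homogeneous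
    intro γ m hm
    have hX : IsExchangeRing (End (F.obj ((shift (-γ)).obj (regular.{w} 𝒜)))) :=
      isExchangeRing_end_obj F (isExchangeRing_end_shift _ _ h)
    have h0 : ofHomogeneous.{w} _ γ m hm ≫ F.inv.map π = 0 := by
      apply F.map_injective
      rw [F.map_comp, F.map_zero]
      refine (Iso.cancel_iso_hom_right _ _ (F.asEquivalence.counitIso.app _)).1 ?_
      refine ((Category.assoc _ _ _).trans ?_).trans Limits.zero_comp.symm
      refine (congrArg (F.map (ofHomogeneous.{w} _ γ m hm) ≫ ·)
        (F.asEquivalence.counitIso.hom.naturality π)).trans ?_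
      exact (Category.assoc _ _ _).symm.trans (comp_toQuotient_exchangeTrace hX _)
    have h1 : Hom.toLinearMap (ofHomogeneous.{w} _ γ m hm ≫ F.inv.map π) (regularOne.{w} 𝒜) = 0 := by
      rw [h0]; rfl
    rw [← ofHomogeneous_one.{w} _ γ m hm]
    exact h1
  have hπ0 : π = 0 := F.inv.map_injective (hπ.trans (F.inv.map_zero _ _).symm)
  rw [eq_top_iff]
  intro n _
  have hn : π.toLinearMap n = 0 := by rw [hπ0]; rfl
  exact (Submodule.Quotient.mk_eq_zero _).1 hn

/-- If `f x = 1`, then `f` also sends the degree-zero part of `x` to `1`, since `f` commutes with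
projections. The morphism sending `1` to that part is a section of `f`. -/
theorem isExchangeRing_end_regular (h : (regular.{w} 𝒜).exchangeTrace = ⊤) :
    IsExchangeRing (End (regular.{w} 𝒜)) := by
  obtain ⟨X, hX, f, x, hx⟩ : regularOne.{w} 𝒜 ∈ (regular.{w} 𝒜).exchangeTrace :=
    by
    rw [h]; trivial
  refine isExchangeRing_end_of_retract hX (ofDegreeZero.{w} X (X.proj 0 x) (X.proj_mem 0 x)) f
    (regular_hom_ext ?_)
  rw [comp_toLinearMap, LinearMap.comp_apply, ofDegreeZero_one, map_proj, hx,
    proj_of_mem _ _ _ one_mem_regular_zero]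
  rfl

theorem epsilonExchange_of_isEquivalence (F : GrMod.{max u v} 𝒜 ⥤ GrMod.{max u v} ℬ)
    [F.IsEquivalence] (h : EpsilonExchange 𝒜) : EpsilonExchange ℬ :=
  (epsilonExchange_iff.{u} ℬ).2 (isExchangeRing_end_regular.{u}
    (exchangeTrace_eq_top_of_isEquivalence.{v} F ((epsilonExchange_iff.{v} 𝒜).1 h) _))

end GrMod

theorem proposition3p10 {Γ : Type*} [AddGroup Γ] [DecidableEq Γ]
    {A : Type u} {B : Type v} [Ring A] [Ring B]
    (𝒜 : Γ → AddSubgroup A) [GradedRing 𝒜] (ℬ : Γ → AddSubgroup B) [GradedRing ℬ]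
    (h : GradedMoritaEquivalent 𝒜 ℬ) :
    EpsilonExchange 𝒜 ↔ EpsilonExchange ℬ := by
  obtain ⟨F, hF, -⟩ := h
  exact ⟨GrMod.epsilonExchange_of_isEquivalence F, GrMod.epsilonExchange_of_isEquivalence F.inv⟩
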